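/- Let $n\ge 1$ and let $\Omega\subset\mathbb R^n$ be a bounded domain (nonempty, open, connected) that is symmetric with respect to the hyperplane $\{x_n=0\}$; write $x=(x',x_n)$ with $x'=(x_1,\dots,x_{n-1})$. (a) Let $f:\Omega\times\mathbb R\to\mathbb R$ be of class $C^1$, convex in the second variable, i.e. $s\mapsto f(x,s)$ is convex on $\mathbb R$ for every $x\in\Omega$, and even in $x_n$, i.e. $f(x',-x_n,s)=f(x',x_n,s)$ for all $x\in\Omega$, $s\in\mathbb R$. Write $f'=\partial f/\partial s$. Let $u\in C^2(\Omega)\cap C(\overline\Omega)$ be a solution of $$-\Delta u=f(x,u)\ \text{ in }\Omega,\qquad u=0\ \text{ on }\partial\Omega,$$ such that the function $x\mapsto f'(x,u(x))$ is bounded on $\Omega$ (this is automatic if $f'$ is bounded on $\Omega\times[-M,M]$ for every $M>0$, in particular if $\nabla f$ is Lipschitz on each of these sets). Suppose that $u$ is stable, i.e. $$\int_\Omega|\nabla\varphi|^2\,dx-\int_\Omega f'(x,u)\,\varphi^2\,dx>0\qquad\text{for all }\varphi\in H^1_0(\Omega),\ \varphi\ne 0,$$ where $H^1_0(\Omega)$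 is the closure of $C_c^\infty(\Omega)$ in the $H^1$ norm. Then $u$ is even in $x_n$: $u(x',-x_n)=u(x',x_n)$ for all $x\in\Omega$. (b) Let $f:\mathbb R\to\mathbb R$ be a convex function of class $C^1$, and let $u\in C^2(\Omega)\cap C(\overline\Omega)$ be a stable solution, in the same sense with $f'(u)$ in place of $f'(x,u)$, of $$-\Delta u=f(u)\ \text{ in }\Omega,\qquad u=0\ \text{ on }\partial\Omega.$$ Then $u(x',-x_n)=u(x',x_n)$ for all $x\in\Omega$. -/

import Mathlib

open MeasureTheory Filter Topology
open scoped ContDiff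

/-- Reflection `(x₁, …, x_{n-1}, x_n) ↦ (x₁, …, x_{n-1}, -x_n)` of `ℝⁿ`, `n = m + 1`,
in the hyperplane `x_n = 0`. -/
def reflectLast {m : ℕ} (x : EuclideanSpace ℝ (Fin (m + 1))) :
    EuclideanSpace ℝ (Fin (m + 1)) :=
  WithLp.toLp 2 fun i => if i = Fin.last m then -x i else x i

/-- `Ω` is a bounded domain (nonempty connected open set) of `ℝⁿ` that is symmetric with respect
to the hyperplane `x_n = 0`. -/
structure IsBoundedSymmetricDomain {m : ℕ} (Ω : Set (EuclideanSpace ℝ (Fin (m + 1)))) : Prop where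
  isOpen : IsOpen Ω
  isConnected : IsConnected Ω
  isBounded : Bornology.IsBounded Ω
  symmetric : ∀ x ∈ Ω, reflectLast x ∈ Ω

/-- `u ∈ C²(Ω) ∩ C(closure Ω)` solves `-Δu = f(x, u)` in `Ω`, `u = 0` on `∂Ω`. -/
structure IsDirichletSolution {m : ℕ} (Ω : Set (EuclideanSpace ℝ (Fin (m + 1))))
    (f : EuclideanSpace ℝ (Fin (m + 1)) → ℝ → ℝ) (u : EuclideanSpace ℝ (Fin (m + 1)) → ℝ) :
    Prop where
  contDiffOn : ContDiffOn ℝ 2 u Ω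
  continuousOn : ContinuousOn u (closure Ω)
  equation : ∀ x ∈ Ω, -(Laplacian.laplacian u x) = f x (u x)
  boundary : ∀ x ∈ frontier Ω, u x = 0

/-- `φ` is a test function on `Ω`, i.e. `φ ∈ C_c^∞(Ω)` (extended by zero). -/
structure IsTestFunction {m : ℕ} (Ω : Set (EuclideanSpace ℝ (Fin (m + 1))))
    (φ : EuclideanSpace ℝ (Fin (m + 1)) → ℝ) : Prop where
  contDiff : ContDiff ℝ ∞ φ
  hasCompactSupport : HasCompactSupport φ
  tsupport_subset : tsupport φ ⊆ Ω

/-- `φ ∈ H¹₀(Ω)`, with gradient `∇φ = G`: the pair `(φ, G)` lies in `L²(Ω) × L²(Ω; ℝⁿ)` and is the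
limit there of pairs `(φₖ, ∇φₖ)` with `φₖ ∈ C_c^∞(Ω)`. So `H¹₀(Ω)` is the closure of `C_c^∞(Ω)` in
the `H¹` norm. -/
structure IsH10WithGradient {m : ℕ} (Ω : Set (EuclideanSpace ℝ (Fin (m + 1))))
    (φ : EuclideanSpace ℝ (Fin (m + 1)) → ℝ)
    (G : EuclideanSpace ℝ (Fin (m + 1)) → EuclideanSpace ℝ (Fin (m + 1))) : Prop where
  memLp : MemLp φ 2 (volume.restrict Ω)
  memLp_gradient : MemLp G 2 (volume.restrict Ω)
  approx : ∃ φk : ℕ → EuclideanSpace ℝ (Fin (m + 1)) → ℝ,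
    (∀ k, IsTestFunction Ω (φk k)) ∧
    Tendsto (fun k => eLpNorm (fun x => φk k x - φ x) 2 (volume.restrict Ω)) atTop (𝓝 0) ∧
    Tendsto (fun k => eLpNorm (fun x => gradient (φk k) x - G x) 2 (volume.restrict Ω))
      atTop (𝓝 0)

/-- The potential `x ↦ f'(x, u(x)) = ∂f/∂s (x, u(x))` of the linearized operator
`-Δ - f'(x, u)`. -/
noncomputable def linearizedPotential {m : ℕ} (f : EuclideanSpace ℝ (Fin (m + 1)) → ℝ → ℝ)
    (u : EuclideanSpace ℝ (Fin (m + 1)) → ℝ) (x : EuclideanSpace ℝ (Fin (m + 1))) : ℝ :=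
  deriv (fun s => f x s) (u x)

/-- `u` is a stable solution: it solves the Dirichlet problem and
`∫_Ω |∇φ|² - ∫_Ω f'(x, u) φ² > 0` for every `φ ∈ H¹₀(Ω)` other than `0`. -/
structure IsStableSolution {m : ℕ} (Ω : Set (EuclideanSpace ℝ (Fin (m + 1))))
    (f : EuclideanSpace ℝ (Fin (m + 1)) → ℝ → ℝ) (u : EuclideanSpace ℝ (Fin (m + 1)) → ℝ) :
    Prop where
  isSolution : IsDirichletSolution Ω f u
  form_pos : ∀ φ G, IsH10WithGradient Ω φ G → ¬ (φ =ᵐ[volume.restrict Ω] 0) →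
    0 < (∫ x in Ω, ‖G x‖ ^ 2) - ∫ x in Ω, linearizedPotential f u x * φ x ^ 2

/-! Let `v` be the reflection of `u` and `p = u - v`. The Laplacian commutes with the reflection and
`f` is even in `x_n`, so `v` solves the same problem. The tangent line of the convex function `f x`
at `u x` gives `-Δp = f(x,u) - f(x,v) ≤ a p` with `a = f'(x,u)`, and `p = 0` on the boundary.
Testing with `p⁺` yields `∫|∇p⁺|² ≤ ∫ a (p⁺)²`, which stability forbids unless `p⁺ = 0`. Hence `u ≤
v` everywhere, and the same inequality at the reflected point gives equality.

The work lies in justifying the test function: `∂Ω` is arbitrary and `∇u` is not assumed square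
integrable. So `p⁺` is replaced by `ramp δ` of `p`, which is `C¹` with compact support in `Ω`.
Green's identity bounds its energy uniformly in `δ`; Fatou then gives `∇p⁺ ∈ L²`, and dominated
convergence gives both `p⁺ ∈ H¹₀(Ω)` and the energy inequality. This is
`nonpos_of_neg_laplacian_le_of_form_pos`; `IsStableSolution.le_reflectLast` applies it to `p`. -/

/-! ### Mollification of compactly supported `C¹` functions. -/

section Mollification

variable {E : Type*} [NormedAddCommGroup E] [InnerProductSpace ℝ E] [FiniteDimensional ℝ E]
  [MeasurableSpace E] [BorelSpace E]

/-- A compactly supported `C¹` function can be approximated, uniformly together with its gradient,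
by smooth functions supported near its support. -/
theorem exists_contDiff_approx_of_hasCompactSupport {Ω : Set E} (hΩ : IsOpen Ω) {φ : E → ℝ}
    (hφ : ContDiff ℝ 1 φ) (hc : HasCompactSupport φ) (hs : tsupport φ ⊆ Ω) {ε : ℝ} (hε : 0 < ε) :
    ∃ ψ : E → ℝ, ContDiff ℝ ∞ ψ ∧ HasCompactSupport ψ ∧ tsupport ψ ⊆ Ω ∧
      (∀ x, ‖ψ x - φ x‖ ≤ ε) ∧ ∀ x, ‖gradient ψ x - gradient φ x‖ ≤ ε := by
  obtain ⟨r, hr, hrΩ⟩ := IsCompact.exists_cthickening_subset_open hc hΩ hs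
  have hφ' : Continuous (fderiv ℝ φ) := hφ.continuous_fderiv (by norm_num)
  obtain ⟨d₁, hd₁, h₁⟩ := Metric.uniformContinuous_iff.1
    (hc.uniformContinuous_of_continuous hφ.continuous) ε hε
  obtain ⟨d₂, hd₂, h₂⟩ := Metric.uniformContinuous_iff.1
    ((hc.fderiv ℝ).uniformContinuous_of_continuous hφ') ε hε
  -- The mollification radius meets three demands: `r` keeps the support in `Ω`, while `d₁` and `d₂`
  -- are the moduli of continuity of `φ` and of its derivative.
  set d := min r (min d₁ d₂) with hd
  have hdpos : 0 < d := lt_min hr (lt_min hd₁ hd₂)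
  let ρ : ContDiffBump (0 : E) := ⟨d / 2, d, half_pos hdpos, half_lt_self hdpos⟩
  let ψ : E → ℝ := convolution (ρ.normed volume) φ (ContinuousLinearMap.lsmul ℝ ℝ) volume
  have hsub : tsupport ψ ⊆ Metric.cthickening r (tsupport φ) := by
    refine closure_minimal ?_ Metric.isClosed_cthickening
    intro x hx
    obtain ⟨y, hy, z, hz, rfl⟩ := support_convolution_subset _ hx
    rw [ρ.support_normed_eq] at hy
    refine Metric.mem_cthickening_of_dist_le _ z r _ (subset_tsupport _ hz) ?_
    have : dist y 0 < d := hy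
    simpa [dist_eq_norm] using (this.le.trans (min_le_left _ _))
  have hψc : HasCompactSupport ψ :=
    HasCompactSupport.of_support_subset_isCompact hc.cthickening ((subset_tsupport _).trans hsub)
  refine ⟨ψ, ?_, hψc, hsub.trans hrΩ, ?_, ?_⟩
  · exact ρ.hasCompactSupport_normed.contDiff_convolution_left _ ρ.contDiff_normed
      hφ.continuous.locallyIntegrable
  · intro x
    rw [← dist_eq_norm]
    refine ρ.dist_normed_convolution_le hφ.continuous.aestronglyMeasurable fun y hy => ?_
    exact (h₁ (lt_of_lt_of_le hy ((min_le_right _ _).trans (min_le_left _ _)))).le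
  · intro x
    have hder := hc.hasFDerivAt_convolution_right (ContinuousLinearMap.lsmul ℝ ℝ)
      (f := ρ.normed volume) (μ := volume)
      (ρ.continuous_normed.locallyIntegrable) hφ x
    -- The derivative of the convolution is again a bump average, now of `fderiv ℝ φ`, so the
    -- estimate used for `φ` applies verbatim to vector values.
    have hL : (ContinuousLinearMap.lsmul ℝ ℝ : ℝ →L[ℝ] ℝ →L[ℝ] ℝ).precompR E =
        (ContinuousLinearMap.lsmul ℝ ℝ : ℝ →L[ℝ] (E →L[ℝ] ℝ) →L[ℝ] (E →L[ℝ] ℝ)) := by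
      ext a b
      simp [ContinuousLinearMap.precompR_apply]
    rw [hL] at hder
    have := ρ.dist_normed_convolution_le (μ := volume) (x₀ := x) (ε := ε)
      hφ'.aestronglyMeasurable fun y hy =>
      (h₂ (lt_of_lt_of_le hy ((min_le_right _ _).trans (min_le_right _ _)))).le
    rw [gradient, gradient, ← map_sub, LinearIsometryEquiv.norm_map, ← dist_eq_norm, hder.fderiv]
    exact this

end Mollification

/-! ### Green's identity on an open set without boundary regularity. -/

section Green

variable {E : Type*} [NormedAddCommGroup E] [InnerProductSpace ℝ E]

/-- Near a point outside `Ω` the factor `φ` vanishes identically, so the values of `w` there do not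
matter. -/
theorem contDiff_mul_of_contDiffOn {Ω : Set E} (hΩ : IsOpen Ω) {n : WithTop ℕ∞}
    {φ w : E → ℝ} (hφ : ContDiff ℝ n φ) (hs : tsupport φ ⊆ Ω)
    (hw : ContDiffOn ℝ n w Ω) : ContDiff ℝ n (fun x => φ x * w x) := by
  rw [contDiff_iff_contDiffAt]
  intro x
  by_cases hx : x ∈ Ω
  · exact hφ.contDiffAt.mul (hw.contDiffAt (hΩ.mem_nhds hx))
  · have : (fun x => φ x * w x) =ᶠ[𝓝 x] fun _ => 0 := by
      filter_upwards [notMem_tsupport_iff_eventuallyEq.1 fun h => hx (hs h)] with y hy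
      simp [hy]
    exact contDiffAt_const.congr_of_eventuallyEq this

variable [FiniteDimensional ℝ E]

/-- Iterated first derivatives are the form in which the product rule applies to `φ ∂ᵢp`. -/
theorem laplacian_eq_sum_fderiv {ι : Type*} [Fintype ι] (b : OrthonormalBasis ι ℝ E)
    {p : E → ℝ} {x : E} (hp : ContDiffAt ℝ 2 p x) :
    Laplacian.laplacian p x = ∑ i, fderiv ℝ (fun y => fderiv ℝ p y (b i)) x (b i) := by
  rw [InnerProductSpace.laplacian_eq_iteratedFDeriv_orthonormalBasis p b]
  refine Finset.sum_congr rfl fun i _ => ?_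
  have hd : DifferentiableAt ℝ (fderiv ℝ p) x :=
    (hp.fderiv_right (m := 1) (by norm_num)).differentiableAt (by norm_num)
  rw [iteratedFDeriv_two_apply, fderiv_clm_apply hd (by fun_prop)]
  simp

variable [MeasurableSpace E] [BorelSpace E]

/-- The integral of a directional derivative of a compactly supported `C¹` function vanishes. -/
theorem integral_fderiv_apply_eq_zero {h : E → ℝ} (hh : ContDiff ℝ 1 h)
    (hc : HasCompactSupport h) (v : E) : ∫ x, fderiv ℝ h x v = 0 := by
  have hi : Integrable (fun x => fderiv ℝ h x v) :=
    ((hh.continuous_fderiv (by norm_num)).clm_apply continuous_const).integrable_of_hasCompactSupport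
      (hc.fderiv_apply ℝ v)
  have := integral_mul_fderiv_eq_neg_fderiv_mul_of_integrable (𝕜 := ℝ) (μ := volume)
    (f := fun _ : E => (1 : ℝ)) (g := h) (v := v) (by simp) (by simpa using hi)
    (by simpa using hh.continuous.integrable_of_hasCompactSupport hc)
    (fun x _ => by fun_prop) (fun x _ => hh.differentiable (by norm_num) x)
  simpa using this

/-- **Green's identity** with a compactly supported test function. -/
theorem integral_inner_gradient_eq_neg_integral_mul_laplacian {Ω : Set E} (hΩ : IsOpen Ω)
    {φ p : E → ℝ} (hφ : ContDiff ℝ 1 φ) (hc : HasCompactSupport φ) (hs : tsupport φ ⊆ Ω)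
    (hp : ContDiffOn ℝ 2 p Ω) :
    Integrable (fun x => inner ℝ (gradient φ x) (gradient p x)) ∧
      Integrable (fun x => φ x * Laplacian.laplacian p x) ∧
      ∫ x, inner ℝ (gradient φ x) (gradient p x) = -∫ x, φ x * Laplacian.laplacian p x := by
  let b := stdOrthonormalBasis ℝ E
  have hp' : ContDiffOn ℝ 1 (fderiv ℝ p) Ω := hp.fderiv_of_isOpen hΩ (by norm_num)
  have hpi : ∀ i, ContDiffOn ℝ 1 (fun y => fderiv ℝ p y (b i)) Ω := fun i =>
    hp'.clm_apply contDiffOn_const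
  -- These are the components of the field `φ ∇p`, whose divergence integrates to zero.
  let h : _ → E → ℝ := fun i x => φ x * fderiv ℝ p x (b i)
  have hh : ∀ i, ContDiff ℝ 1 (h i) := fun i =>
    contDiff_mul_of_contDiffOn hΩ hφ hs (hpi i)
  have hhc : ∀ i, HasCompactSupport (h i) := fun i => hc.mul_right
  have hφ0 : ∀ x ∉ Ω, φ x = 0 ∧ fderiv ℝ φ x = 0 := fun x hx =>
    ⟨image_eq_zero_of_notMem_tsupport fun h => hx (hs h),
      image_eq_zero_of_notMem_tsupport fun h => hx (hs (tsupport_fderiv_subset ℝ h))⟩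
  have hderiv : ∀ x, ∑ i, fderiv ℝ (h i) x (b i) =
      inner ℝ (gradient φ x) (gradient p x) + φ x * Laplacian.laplacian p x := by
    intro x
    by_cases hx : x ∈ Ω
    · have hpx : ContDiffAt ℝ 2 p x := hp.contDiffAt (hΩ.mem_nhds hx)
      rw [laplacian_eq_sum_fderiv b hpx, Finset.mul_sum, ← b.sum_inner_mul_inner,
        ← Finset.sum_add_distrib]
      refine Finset.sum_congr rfl fun i _ => ?_
      have h1 : DifferentiableAt ℝ (fun y => fderiv ℝ p y (b i)) x :=
        ((hpi i).contDiffAt (hΩ.mem_nhds hx)).differentiableAt (by norm_num)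
      have h2 : DifferentiableAt ℝ φ x := hφ.differentiable (by norm_num) x
      rw [fderiv_fun_mul h2 h1, real_inner_comm (gradient p x) (b i)]
      simp [gradient, InnerProductSpace.toDual_symm_apply]
      ring
    · have : ∀ i, fderiv ℝ (h i) x = 0 := fun i =>
        image_eq_zero_of_notMem_tsupport fun hmem =>
          hx (hs (tsupport_mul_subset_left (tsupport_fderiv_subset ℝ hmem)))
      simp [this, hφ0 x hx, gradient]
  have hint : ∀ i, Integrable (fun x => fderiv ℝ (h i) x (b i)) := fun i =>
    (((hh i).continuous_fderiv (by norm_num)).clm_apply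
      continuous_const).integrable_of_hasCompactSupport ((hhc i).fderiv_apply ℝ _)
  have hsum : ∫ x, ∑ i, fderiv ℝ (h i) x (b i) = 0 := by
    rw [integral_finsetSum _ fun i _ => hint i]
    exact Finset.sum_eq_zero fun i _ => integral_fderiv_apply_eq_zero (hh i) (hhc i) _
  have hlap : Integrable (fun x => φ x * Laplacian.laplacian p x) := by
    have hcont : ContinuousOn (Laplacian.laplacian p) Ω := by
      have : ContinuousOn (fun x => ∑ i, fderiv ℝ (fun y => fderiv ℝ p y (b i)) x (b i)) Ω :=
        continuousOn_finsetSum _ fun i _ =>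
          ((hpi i).continuousOn_fderiv_of_isOpen hΩ le_rfl).clm_apply continuousOn_const
      exact this.congr fun x hx => laplacian_eq_sum_fderiv b (hp.contDiffAt (hΩ.mem_nhds hx))
    refine Continuous.integrable_of_hasCompactSupport ?_ hc.mul_right
    rw [← contDiff_zero (𝕜 := ℝ)]
    exact contDiff_mul_of_contDiffOn hΩ (hφ.of_le (by norm_num)) hs
      (contDiffOn_zero.2 hcont)
  have hinner : Integrable (fun x => inner ℝ (gradient φ x) (gradient p x)) := by
    have := (integrable_finsetSum Finset.univ fun i _ => hint i).sub hlap
    refine this.congr (ae_of_all _ fun x => ?_)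
    simp [hderiv]
  refine ⟨hinner, hlap, ?_⟩
  simp_rw [hderiv] at hsum
  rw [integral_add hinner hlap] at hsum
  linarith

end Green

/-! ### A `C¹` truncation of the positive part. -/

section Ramp

/-- The derivative of `ramp δ`. -/
noncomputable def rampDeriv (δ t : ℝ) : ℝ := max 0 (min 1 (t / δ - 1))

/-- A `C¹` approximation of `t ↦ max t 0` which vanishes for `t ≤ δ`. -/
noncomputable def ramp (δ t : ℝ) : ℝ := ∫ s in (0 : ℝ)..t, rampDeriv δ s

theorem continuous_rampDeriv (δ : ℝ) : Continuous (rampDeriv δ) := by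
  unfold rampDeriv; fun_prop

theorem rampDeriv_nonneg (δ t : ℝ) : 0 ≤ rampDeriv δ t := le_max_left _ _

theorem rampDeriv_le_one (δ t : ℝ) : rampDeriv δ t ≤ 1 :=
  max_le zero_le_one (min_le_left _ _)

theorem rampDeriv_of_le {δ t : ℝ} (hδ : 0 < δ) (h : t ≤ δ) : rampDeriv δ t = 0 := by
  have : t / δ ≤ 1 := (div_le_one hδ).2 h
  exact max_eq_left ((min_le_right _ _).trans (by linarith))

theorem rampDeriv_of_two_mul_le {δ t : ℝ} (hδ : 0 < δ) (h : 2 * δ ≤ t) : rampDeriv δ t = 1 := by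
  have : 2 ≤ t / δ := (le_div_iff₀ hδ).2 h
  rw [rampDeriv, min_eq_left (by linarith), max_eq_right zero_le_one]

theorem hasDerivAt_ramp (δ t : ℝ) : HasDerivAt (ramp δ) (rampDeriv δ t) t :=
  intervalIntegral.integral_hasDerivAt_right ((continuous_rampDeriv δ).intervalIntegrable _ _)
    ((continuous_rampDeriv δ).stronglyMeasurableAtFilter _ _) (continuous_rampDeriv δ).continuousAt

theorem contDiff_ramp (δ : ℝ) : ContDiff ℝ 1 (ramp δ) := by
  rw [contDiff_one_iff_deriv]
  refine ⟨fun t => (hasDerivAt_ramp δ t).differentiableAt, ?_⟩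
  rw [show deriv (ramp δ) = rampDeriv δ from funext fun t => (hasDerivAt_ramp δ t).deriv]
  exact continuous_rampDeriv δ

theorem ramp_of_le {δ t : ℝ} (hδ : 0 < δ) (h : t ≤ δ) : ramp δ t = 0 := by
  rw [ramp, intervalIntegral.integral_congr (g := fun _ => (0 : ℝ)), intervalIntegral.integral_zero]
  intro s hs
  exact rampDeriv_of_le hδ (hs.2.trans (max_le hδ.le h))

theorem monotone_ramp (δ : ℝ) : Monotone (ramp δ) :=
  monotone_of_deriv_nonneg (fun t => (hasDerivAt_ramp δ t).differentiableAt) fun t => by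
    rw [(hasDerivAt_ramp δ t).deriv]; exact rampDeriv_nonneg δ t

theorem ramp_nonneg {δ : ℝ} (hδ : 0 < δ) (t : ℝ) : 0 ≤ ramp δ t := by
  rw [← ramp_of_le hδ ((min_le_left δ t))]
  exact monotone_ramp δ (min_le_right _ _)

theorem monotone_sub_ramp (δ : ℝ) : Monotone fun t => t - ramp δ t :=
  monotone_of_deriv_nonneg
    (fun t => ((hasDerivAt_id t).sub (hasDerivAt_ramp δ t)).differentiableAt) fun t => by
    rw [((hasDerivAt_id' t).fun_sub (hasDerivAt_ramp δ t)).deriv]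
    linarith [rampDeriv_le_one δ t]

theorem ramp_le_max {δ : ℝ} (hδ : 0 < δ) (t : ℝ) : ramp δ t ≤ max t 0 := by
  rcases le_total t 0 with h | h
  · rw [ramp_of_le hδ (h.trans hδ.le)]; exact le_max_right _ _
  · have := monotone_sub_ramp δ h
    simp only [ramp_of_le hδ hδ.le] at this
    rw [max_eq_left h]; linarith

/-- Beyond `2 * δ` the slope is one, so the lag behind the positive part stops growing there. The
exact lag is `3δ/2`; the cruder bound suffices for the limit. -/
theorem sub_two_mul_le_ramp {δ : ℝ} (hδ : 0 < δ) (t : ℝ) : max t 0 - 2 * δ ≤ ramp δ t := by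
  rcases le_total t (2 * δ) with h | h
  · have : max t 0 ≤ 2 * δ := max_le h (by linarith)
    linarith [ramp_nonneg hδ t]
  · have h0 : (0 : ℝ) ≤ t := by linarith
    have h1 : ramp δ t - ramp δ (2 * δ) = t - 2 * δ := by
      rw [ramp, ramp, intervalIntegral.integral_interval_sub_left
        ((continuous_rampDeriv δ).intervalIntegrable _ _)
        ((continuous_rampDeriv δ).intervalIntegrable _ _),
        intervalIntegral.integral_congr (g := fun _ => (1 : ℝ))]
      · simp
      · intro s hs
        rw [Set.uIcc_of_le h] at hs
        exact rampDeriv_of_two_mul_le hδ hs.1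
    rw [max_eq_left h0]
    linarith [ramp_nonneg hδ (2 * δ)]

theorem tendsto_ramp {δ : ℕ → ℝ} (hpos : ∀ k, 0 < δ k) (hδ : Tendsto δ atTop (𝓝 0)) (t : ℝ) :
    Tendsto (fun k => ramp (δ k) t) atTop (𝓝 (max t 0)) := by
  refine tendsto_of_tendsto_of_tendsto_of_le_of_le (g := fun k => max t 0 - 2 * δ k)
    (by simpa using (hδ.const_mul 2).const_sub (max t 0)) tendsto_const_nhds
    (fun k => sub_two_mul_le_ramp (hpos k) t) fun k => ramp_le_max (hpos k) t

/-- The sequence is eventually constant. At `t = 0` the limit is `0`, so the limiting gradient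
vanishes on the zero set of `p`. -/
theorem tendsto_rampDeriv {δ : ℕ → ℝ} (hpos : ∀ k, 0 < δ k) (hδ : Tendsto δ atTop (𝓝 0)) (t : ℝ) :
    Tendsto (fun k => rampDeriv (δ k) t) atTop (𝓝 (if 0 < t then 1 else 0)) := by
  refine tendsto_const_nhds.congr' ?_
  split_ifs with h
  · filter_upwards [hδ.eventually_lt_const (half_pos h)] with k hk
    exact (rampDeriv_of_two_mul_le (hpos k) (by linarith)).symm
  · exact Eventually.of_forall fun k =>
      (rampDeriv_of_le (hpos k) ((not_lt.1 h).trans (hpos k).le)).symm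

end Ramp

/-! ### Dominated convergence in `L²` and a Fatou criterion. -/

section LimitTheorems

variable {α F : Type*} [MeasurableSpace α] {μ : Measure α} [NormedAddCommGroup F]

/-- Dominated convergence in `L²`. -/
theorem tendsto_eLpNorm_two_of_dominated {D : ℕ → α → F} {g : α → ℝ}
    (hD : ∀ k, AEStronglyMeasurable (D k) μ) (hg : MemLp g 2 μ)
    (hbound : ∀ k, ∀ᵐ x ∂μ, ‖D k x‖ ≤ g x)
    (hlim : ∀ᵐ x ∂μ, Tendsto (fun k => D k x) atTop (𝓝 0)) :
    Tendsto (fun k => eLpNorm (D k) 2 μ) atTop (𝓝 0) := by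
  have h2 : Tendsto (fun k => ∫⁻ x, ‖D k x‖ₑ ^ (2 : ℝ) ∂μ) atTop (𝓝 (∫⁻ _, 0 ∂μ)) := by
    refine tendsto_lintegral_of_dominated_convergence' (fun x => ‖g x‖ₑ ^ (2 : ℝ))
      (fun k => (hD k).enorm.pow_const _) (fun k => ?_) ?_ ?_
    · filter_upwards [hbound k] with x hx
      gcongr
      rw [enorm_le_iff_norm_le]
      exact hx.trans (le_abs_self _)
    · have := (eLpNorm_lt_top_iff_lintegral_rpow_enorm_lt_top (by norm_num) (by norm_num)).1 hg.2
      simpa using this.ne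
    · filter_upwards [hlim] with x hx
      have := (ENNReal.continuous_rpow_const (y := 2)).tendsto _ |>.comp
        ((continuous_enorm.tendsto (0 : F)).comp hx)
      simpa [Function.comp_def] using this
  have h3 := (ENNReal.continuous_rpow_const (y := 1 / 2)).tendsto _ |>.comp h2
  simp only [lintegral_zero] at h3
  rw [ENNReal.zero_rpow_of_pos (by norm_num)] at h3
  refine h3.congr fun k => ?_
  rw [eLpNorm_eq_lintegral_rpow_enorm_toReal (by norm_num) (by norm_num)]
  simp

/-- A pointwise limit of nonnegative functions with bounded integrals is integrable. -/
theorem integrable_of_tendsto_of_integral_le {D : ℕ → α → ℝ} {f : α → ℝ} {C : ℝ}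
    (hD : ∀ k, Integrable (D k) μ) (h0 : ∀ k, 0 ≤ᵐ[μ] D k) (hC : ∀ k, ∫ x, D k x ∂μ ≤ C)
    (hlim : ∀ᵐ x ∂μ, Tendsto (fun k => D k x) atTop (𝓝 (f x))) : Integrable f μ := by
  refine ⟨aestronglyMeasurable_of_tendsto_ae _ (fun k => (hD k).1) hlim, ?_⟩
  have hle : ∫⁻ x, ‖f x‖ₑ ∂μ ≤ liminf (fun k => ∫⁻ x, ‖D k x‖ₑ ∂μ) atTop := by
    refine le_trans (lintegral_mono_ae ?_) (lintegral_liminf_le' fun k => (hD k).1.enorm)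
    filter_upwards [hlim] with x hx
    exact ((continuous_enorm.tendsto _).comp hx).liminf_eq.ge
  refine lt_of_le_of_lt hle ?_
  refine lt_of_le_of_lt (b := ENNReal.ofReal C) ?_ ENNReal.ofReal_lt_top
  refine liminf_le_of_frequently_le' (Frequently.of_forall fun k => ?_)
  rw [← ofReal_integral_norm_eq_lintegral_enorm (hD k)]
  refine ENNReal.ofReal_le_ofReal ((integral_congr_ae ?_).trans_le (hC k))
  filter_upwards [h0 k] with x hx
  exact Real.norm_of_nonneg hx

end LimitTheorems

/-! ### The truncations as compactly supported `C¹` functions. -/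

section Truncation

variable {E : Type*} [NormedAddCommGroup E] {Ω : Set E} {p : E → ℝ} {δ : ℝ}

/-- The support lies in the closed set where `p ≥ δ` in `closure Ω`, and this misses the frontier
because `p = 0 < δ` there. -/
theorem tsupport_indicator_ramp_subset (hΩ : IsOpen Ω) (hpc : ContinuousOn p (closure Ω))
    (hp0 : ∀ x ∈ frontier Ω, p x = 0) (hδ : 0 < δ) :
    tsupport (Ω.indicator fun x => ramp δ (p x)) ⊆ Ω := by
  have hK : IsClosed (closure Ω ∩ p ⁻¹' Set.Ici δ) :=
    hpc.preimage_isClosed_of_isClosed isClosed_closure isClosed_Ici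
  have hsub : tsupport (Ω.indicator fun x => ramp δ (p x)) ⊆ closure Ω ∩ p ⁻¹' Set.Ici δ := by
    refine closure_minimal (fun x hx => ?_) hK
    have hxΩ : x ∈ Ω := Set.mem_of_indicator_ne_zero hx
    refine ⟨subset_closure hxΩ, ?_⟩
    by_contra hlt
    exact hx (by rw [Set.indicator_of_mem hxΩ, ramp_of_le hδ (not_le.1 hlt).le])
  intro x hx
  obtain ⟨hxc, hxp⟩ := hsub hx
  by_contra hxΩ
  have : p x = 0 := hp0 x ⟨hxc, by rwa [hΩ.interior_eq]⟩
  have hxp' : δ ≤ p x := hxp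
  linarith

variable [InnerProductSpace ℝ E]

theorem hasCompactSupport_indicator [FiniteDimensional ℝ E] (hb : Bornology.IsBounded Ω) (f : E → ℝ) :
    HasCompactSupport (Ω.indicator f) :=
  HasCompactSupport.of_support_subset_isCompact hb.isCompact_closure
    (Set.support_indicator_subset.trans subset_closure)

theorem contDiff_indicator_ramp (hΩ : IsOpen Ω) (hp : ContDiffOn ℝ 2 p Ω)
    (hs : tsupport (Ω.indicator fun x => ramp δ (p x)) ⊆ Ω) :
    ContDiff ℝ 1 (Ω.indicator fun x => ramp δ (p x)) := by
  rw [contDiff_iff_contDiffAt]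
  intro x
  by_cases hx : x ∈ Ω
  · have h1 : ContDiffAt ℝ 1 (fun x => ramp δ (p x)) x :=
      (contDiff_ramp δ).contDiffAt.comp x
        ((hp.contDiffAt (hΩ.mem_nhds hx)).of_le (by norm_num))
    refine h1.congr_of_eventuallyEq ?_
    filter_upwards [hΩ.mem_nhds hx] with y hy
    exact Set.indicator_of_mem hy _
  · exact contDiffAt_const.congr_of_eventuallyEq
      (notMem_tsupport_iff_eventuallyEq.1 fun h => hx (hs h))

theorem gradient_indicator_ramp [FiniteDimensional ℝ E] (hΩ : IsOpen Ω) (hp : ContDiffOn ℝ 2 p Ω) {x : E} (hx : x ∈ Ω) :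
    gradient (Ω.indicator fun x => ramp δ (p x)) x = rampDeriv δ (p x) • gradient p x := by
  have h1 : HasFDerivAt p (fderiv ℝ p x) x :=
    ((hp.contDiffAt (hΩ.mem_nhds hx)).differentiableAt (by norm_num)).hasFDerivAt
  have h2 := (hasDerivAt_ramp δ (p x)).comp_hasFDerivAt x h1
  have h3 : (Ω.indicator fun x => ramp δ (p x)) =ᶠ[𝓝 x] ramp δ ∘ p := by
    filter_upwards [hΩ.mem_nhds hx] with y hy
    exact Set.indicator_of_mem hy _
  rw [gradient, h3.fderiv_eq, h2.fderiv, map_smul, gradient]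

theorem continuous_gradient [FiniteDimensional ℝ E] (hp : ContDiff ℝ 1 p) : Continuous (gradient p) :=
  (InnerProductSpace.toDual ℝ E).symm.continuous.comp (hp.continuous_fderiv (by norm_num))

theorem continuousOn_gradient [FiniteDimensional ℝ E] (hΩ : IsOpen Ω) (hp : ContDiffOn ℝ 2 p Ω) :
    ContinuousOn (gradient p) Ω :=
  (InnerProductSpace.toDual ℝ E).symm.continuous.comp_continuousOn
    (hp.continuousOn_fderiv_of_isOpen hΩ (by norm_num))

end Truncation

/-! ### The maximum principle for a positive quadratic form. -/

section MaximumPrinciple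

variable {m : ℕ} {Ω : Set (EuclideanSpace ℝ (Fin (m + 1)))}

/-- `H¹₀` contains the `L²` limits of compactly supported `C¹` functions. -/
theorem isH10WithGradient_of_tendsto (hΩ : IsOpen Ω) (hb : Bornology.IsBounded Ω)
    {φ : EuclideanSpace ℝ (Fin (m + 1)) → ℝ}
    {G : EuclideanSpace ℝ (Fin (m + 1)) → EuclideanSpace ℝ (Fin (m + 1))}
    (hφ : MemLp φ 2 (volume.restrict Ω)) (hG : MemLp G 2 (volume.restrict Ω))
    {w : ℕ → EuclideanSpace ℝ (Fin (m + 1)) → ℝ} (hw : ∀ k, ContDiff ℝ 1 (w k))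
    (hwc : ∀ k, HasCompactSupport (w k)) (hws : ∀ k, tsupport (w k) ⊆ Ω)
    (h0 : Tendsto (fun k => eLpNorm (fun x => w k x - φ x) 2 (volume.restrict Ω)) atTop (𝓝 0))
    (h1 : Tendsto (fun k => eLpNorm (fun x => gradient (w k) x - G x) 2 (volume.restrict Ω))
      atTop (𝓝 0)) :
    IsH10WithGradient Ω φ G := by
  have hfin : IsFiniteMeasure (volume.restrict Ω) := ⟨by simpa using hb.measure_lt_top⟩
  choose ψ hψ hψc hψs hψ0 hψ1 using fun k : ℕ =>
    exists_contDiff_approx_of_hasCompactSupport hΩ (hw k) (hwc k) (hws k)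
      (Nat.one_div_pos_of_nat (α := ℝ) (n := k))
  -- `Ω` has finite measure, so a uniform error `ε` costs at most `c * ε` in `L²`.
  let c : ENNReal := (volume.restrict Ω) Set.univ ^ (2 : ENNReal).toReal⁻¹
  have hc : c ≠ ⊤ := ENNReal.rpow_ne_top_of_nonneg (by positivity) (measure_ne_top _ _)
  have hsmall : Tendsto (fun k : ℕ => c * ENNReal.ofReal (1 / ((k : ℝ) + 1))) atTop (𝓝 0) := by
    have := ENNReal.tendsto_ofReal (tendsto_one_div_add_atTop_nhds_zero_nat (𝕜 := ℝ))
    simpa using ENNReal.Tendsto.const_mul this (Or.inr hc)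
  have hψ' : ∀ k, ContDiff ℝ 1 (ψ k) := fun k => (hψ k).of_le (by exact_mod_cast le_top)
  refine ⟨hφ, hG, ψ, fun k => ⟨hψ k, hψc k, hψs k⟩, ?_, ?_⟩
  · refine tendsto_of_tendsto_of_tendsto_of_le_of_le tendsto_const_nhds
      (by simpa only [add_zero] using hsmall.add h0) (fun _ => zero_le) fun k => ?_
    have hadd := eLpNorm_add_le (p := 2) (μ := volume.restrict Ω) (f := fun x => ψ k x - w k x)
      (g := fun x => w k x - φ x)
      ((hψ k).continuous.sub (hw k).continuous).aestronglyMeasurable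
      ((hw k).continuous.aestronglyMeasurable.sub hφ.1) (by norm_num)
    have hbd := eLpNorm_le_of_ae_bound (p := 2) (ae_of_all (volume.restrict Ω) (hψ0 k))
    refine le_trans (le_of_eq ?_) (hadd.trans (add_le_add_left hbd _))
    congr 1; ext x; simp
  · refine tendsto_of_tendsto_of_tendsto_of_le_of_le tendsto_const_nhds
      (by simpa only [add_zero] using hsmall.add h1) (fun _ => zero_le) fun k => ?_
    have hadd := eLpNorm_add_le (p := 2) (μ := volume.restrict Ω)
      (f := fun x => gradient (ψ k) x - gradient (w k) x)
      (g := fun x => gradient (w k) x - G x)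
      ((continuous_gradient (hψ' k)).sub (continuous_gradient (hw k))).aestronglyMeasurable
      ((continuous_gradient (hw k)).aestronglyMeasurable.sub hG.1) (by norm_num)
    have hbd := eLpNorm_le_of_ae_bound (p := 2) (ae_of_all (volume.restrict Ω) (hψ1 k))
    refine le_trans (le_of_eq ?_) (hadd.trans (add_le_add_left hbd _))
    congr 1; ext x; simp

/-- **Maximum principle**: if the quadratic form of `-Δ - a` is positive on `H¹₀(Ω)`, then a
subsolution of `-Δp = a p` vanishing on the boundary is nonpositive. -/
theorem nonpos_of_neg_laplacian_le_of_form_pos (hΩ : IsOpen Ω) (hb : Bornology.IsBounded Ω)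
    {p a : EuclideanSpace ℝ (Fin (m + 1)) → ℝ} (hp : ContDiffOn ℝ 2 p Ω)
    (hpc : ContinuousOn p (closure Ω)) (hp0 : ∀ x ∈ frontier Ω, p x = 0)
    (ha : ContinuousOn a Ω) {C : ℝ} (hC : ∀ x ∈ Ω, |a x| ≤ C)
    (hle : ∀ x ∈ Ω, -(Laplacian.laplacian p x) ≤ a x * p x)
    (hpos : ∀ φ G, IsH10WithGradient Ω φ G → ¬ (φ =ᵐ[volume.restrict Ω] 0) →
      0 < (∫ x in Ω, ‖G x‖ ^ 2) - ∫ x in Ω, a x * φ x ^ 2) :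
    ∀ x ∈ Ω, p x ≤ 0 := by
  have hfin : IsFiniteMeasure (volume.restrict Ω) := ⟨by simpa using hb.measure_lt_top⟩
  have hms := hΩ.measurableSet
  obtain ⟨M, hM⟩ := hb.isCompact_closure.exists_bound_of_continuousOn hpc
  have hMΩ : ∀ x ∈ Ω, |p x| ≤ M := fun x hx => hM x (subset_closure hx)
  have hpΩ : ContinuousOn p Ω := hpc.mono subset_closure
  have hgrad := continuousOn_gradient hΩ hp
  set δ : ℕ → ℝ := fun k => 1 / ((k : ℝ) + 1)
  have hδ : ∀ k, 0 < δ k := fun k => Nat.one_div_pos_of_nat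
  have hδ0 : Tendsto δ atTop (𝓝 0) := tendsto_one_div_add_atTop_nhds_zero_nat
  let w : ℕ → EuclideanSpace ℝ (Fin (m + 1)) → ℝ := fun k => Ω.indicator fun x => ramp (δ k) (p x)
  have hws : ∀ k, tsupport (w k) ⊆ Ω := fun k =>
    tsupport_indicator_ramp_subset hΩ hpc hp0 (hδ k)
  have hwc : ∀ k, HasCompactSupport (w k) := fun k => hasCompactSupport_indicator hb _
  have hw : ∀ k, ContDiff ℝ 1 (w k) := fun k => contDiff_indicator_ramp hΩ hp (hws k)
  have hwg : ∀ k, ∀ x ∈ Ω, gradient (w k) x = rampDeriv (δ k) (p x) • gradient p x :=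
    fun k x hx => gradient_indicator_ramp hΩ hp hx
  have hwΩ : ∀ k, ∀ x ∈ Ω, w k x = ramp (δ k) (p x) := fun k x hx => Set.indicator_of_mem hx _
  have hramp : ∀ k, ∀ x ∈ Ω, |ramp (δ k) (p x)| ≤ M := fun k x hx => by
    rw [abs_of_nonneg (ramp_nonneg (hδ k) _)]
    exact (ramp_le_max (hδ k) _).trans
      (max_le ((le_abs_self _).trans (hMΩ x hx)) ((abs_nonneg _).trans (hMΩ x hx)))
  have hrd := continuous_rampDeriv
  have hrc : ∀ k, Continuous (ramp (δ k)) := fun k => (contDiff_ramp (δ k)).continuous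
  have hB : ∀ k, ContinuousOn (fun x => a x * p x * ramp (δ k) (p x)) Ω := fun k =>
    (ha.mul hpΩ).mul ((hrc k).comp_continuousOn hpΩ)
  have hBb : ∀ k, ∀ x ∈ Ω, ‖a x * p x * ramp (δ k) (p x)‖ ≤ C * M * M := fun k x hx => by
    rw [norm_mul, norm_mul]
    have h1 := hC x hx; have h2 := hMΩ x hx; have h3 := hramp k x hx
    have := (abs_nonneg _).trans h1; have := (abs_nonneg _).trans h2
    simp only [Real.norm_eq_abs]
    gcongr
  have hBi : ∀ k, Integrable (fun x => a x * p x * ramp (δ k) (p x)) (volume.restrict Ω) :=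
    fun k => Integrable.of_bound ((hB k).aestronglyMeasurable hms) (C * M * M)
      ((ae_restrict_iff' hms).2 (ae_of_all _ (hBb k)))
  -- The differential inequality is tested with `w k`; its sign survives because `ramp` is
  -- nonnegative.
  have hgreen : ∀ k, Integrable (fun x => rampDeriv (δ k) (p x) * ‖gradient p x‖ ^ 2)
        (volume.restrict Ω) ∧
      ∫ x in Ω, rampDeriv (δ k) (p x) * ‖gradient p x‖ ^ 2 ≤
        ∫ x in Ω, a x * p x * ramp (δ k) (p x) := by
    intro k
    obtain ⟨hi, hj, heq⟩ := integral_inner_gradient_eq_neg_integral_mul_laplacian hΩ (hw k)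
      (hwc k) (hws k) hp
    have hoff : ∀ x ∉ Ω, x ∉ tsupport (w k) := fun x hx h => hx (hws k h)
    have hi0 : ∀ x ∉ Ω, inner ℝ (gradient (w k) x) (gradient p x) = 0 := fun x hx => by
      rw [gradient, image_eq_zero_of_notMem_tsupport
        fun h => hoff x hx (tsupport_fderiv_subset ℝ h), map_zero, inner_zero_left]
    have hj0 : ∀ x ∉ Ω, w k x * Laplacian.laplacian p x = 0 := fun x hx => by
      rw [image_eq_zero_of_notMem_tsupport (hoff x hx), zero_mul]
    rw [← setIntegral_eq_integral_of_forall_compl_eq_zero hi0,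
      ← setIntegral_eq_integral_of_forall_compl_eq_zero hj0, ← integral_neg] at heq
    have hcongr : Set.EqOn (fun x => inner ℝ (gradient (w k) x) (gradient p x))
        (fun x => rampDeriv (δ k) (p x) * ‖gradient p x‖ ^ 2) Ω := fun x hx => by
      simp only [hwg k x hx, real_inner_smul_left, real_inner_self_eq_norm_sq]
    rw [setIntegral_congr_fun hms hcongr] at heq
    refine ⟨hi.integrableOn.congr_fun hcongr hms, heq.trans_le ?_⟩
    refine setIntegral_mono_on hj.neg.integrableOn (hBi k) hms fun x hx => ?_
    rw [hwΩ k x hx]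
    have := mul_le_mul_of_nonneg_right (hle x hx) (ramp_nonneg (hδ k) (p x))
    linarith
  have hAlim : ∀ x, Tendsto (fun k => rampDeriv (δ k) (p x) * ‖gradient p x‖ ^ 2) atTop
      (𝓝 ((if 0 < p x then 1 else 0) * ‖gradient p x‖ ^ 2)) := fun x =>
    (tendsto_rampDeriv hδ hδ0 (p x)).mul_const _
  have hBle : ∀ k, ∫ x in Ω, a x * p x * ramp (δ k) (p x) ≤
      C * M * M * (volume.restrict Ω).real Set.univ := fun k =>
    (le_abs_self _).trans (norm_integral_le_of_norm_le_const
      ((ae_restrict_iff' hms).2 (ae_of_all _ (hBb k))))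
  -- Square integrability of `∇p⁺` comes from Fatou: the truncated energies are bounded
  -- independently of `k`.
  have hlimint : Integrable (fun x => (if 0 < p x then 1 else 0) * ‖gradient p x‖ ^ 2)
      (volume.restrict Ω) :=
    integrable_of_tendsto_of_integral_le (fun k => (hgreen k).1)
      (fun k => ae_of_all _ fun x => mul_nonneg (rampDeriv_nonneg _ _) (sq_nonneg _))
      (fun k => (hgreen k).2.trans (hBle k)) (ae_of_all _ hAlim)
  let φ : EuclideanSpace ℝ (Fin (m + 1)) → ℝ := fun x => max (p x) 0
  let G : EuclideanSpace ℝ (Fin (m + 1)) → EuclideanSpace ℝ (Fin (m + 1)) := fun x =>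
    (if 0 < p x then (1 : ℝ) else 0) • gradient p x
  have hGsq : ∀ x, ‖G x‖ ^ 2 = (if 0 < p x then 1 else 0) * ‖gradient p x‖ ^ 2 := fun x => by
    simp only [G]; split_ifs <;> simp
  have hGlim : ∀ x, Tendsto (fun k => rampDeriv (δ k) (p x) • gradient p x) atTop (𝓝 (G x)) :=
    fun x => (tendsto_rampDeriv hδ hδ0 (p x)).smul_const _
  have hGm : AEStronglyMeasurable G (volume.restrict Ω) :=
    aestronglyMeasurable_of_tendsto_ae atTop
      (fun k => (((hrd (δ k)).comp_continuousOn hpΩ).smul hgrad).aestronglyMeasurable hms)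
      (ae_of_all _ hGlim)
  have hG : MemLp G 2 (volume.restrict Ω) := by
    rw [memLp_two_iff_integrable_sq_norm hGm]
    simpa only [hGsq] using hlimint
  have hφc : ContinuousOn φ Ω := ContinuousOn.sup hpΩ continuousOn_const
  have hφM : ∀ x ∈ Ω, ‖φ x‖ ≤ M := fun x hx => by
    rw [Real.norm_of_nonneg (le_max_right _ _)]
    exact max_le ((le_abs_self _).trans (hMΩ x hx)) ((abs_nonneg _).trans (hMΩ x hx))
  have hφ : MemLp φ 2 (volume.restrict Ω) :=
    MemLp.of_bound (hφc.aestronglyMeasurable hms) M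
      ((ae_restrict_iff' hms).2 (ae_of_all _ hφM))
  have hH : IsH10WithGradient Ω φ G := by
    refine isH10WithGradient_of_tendsto hΩ hb hφ hG hw hwc hws ?_ ?_
    · refine tendsto_eLpNorm_two_of_dominated (g := fun _ => M + M)
        (fun k => (hw k).continuous.aestronglyMeasurable.sub hφ.1) (memLp_const _) (fun k => ?_) ?_
      · filter_upwards [ae_restrict_mem hms] with x hx
        refine (norm_sub_le _ _).trans (add_le_add ?_ (hφM x hx))
        rw [hwΩ k x hx]
        exact hramp k x hx
      · filter_upwards [ae_restrict_mem hms] with x hx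
        simp only [hwΩ _ x hx]
        simpa [φ] using (tendsto_ramp hδ hδ0 (p x)).sub_const (φ x)
    · refine tendsto_eLpNorm_two_of_dominated (g := fun x => ‖G x‖)
        (fun k => AEStronglyMeasurable.sub ?_ hGm) hG.norm (fun k => ?_) ?_
      · exact (continuous_gradient (hw k)).aestronglyMeasurable
      · filter_upwards [ae_restrict_mem hms] with x hx
        rw [hwg k x hx, ← sub_smul, norm_smul, norm_smul]
        -- The difference between `rampDeriv` and the indicator of `p > 0` is at most that
        -- indicator, so `‖G‖` dominates.
        gcongr
        split_ifs with h
        · rw [Real.norm_eq_abs, norm_one, abs_le]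
          constructor <;> linarith [rampDeriv_nonneg (δ k) (p x), rampDeriv_le_one (δ k) (p x)]
        · rw [rampDeriv_of_le (hδ k) ((not_lt.1 h).trans (hδ k).le)]
          simp
      · filter_upwards [ae_restrict_mem hms] with x hx
        simp only [hwg _ x hx]
        simpa using (hGlim x).sub_const (G x)
  have henergy : ∫ x in Ω, ‖G x‖ ^ 2 ≤ ∫ x in Ω, a x * φ x ^ 2 := by
    have hlim1 : Tendsto (fun k => ∫ x in Ω, rampDeriv (δ k) (p x) * ‖gradient p x‖ ^ 2) atTop
        (𝓝 (∫ x in Ω, ‖G x‖ ^ 2)) := by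
      refine tendsto_integral_of_dominated_convergence (fun x => ‖G x‖ ^ 2)
        (fun k => (hgreen k).1.1) (by simpa only [hGsq] using hlimint)
        (fun k => ae_of_all _ fun x => ?_) (ae_of_all _ fun x => by rw [hGsq]; exact hAlim x)
      rw [hGsq, Real.norm_of_nonneg (mul_nonneg (rampDeriv_nonneg _ _) (sq_nonneg _))]
      gcongr
      split_ifs with h
      · exact rampDeriv_le_one _ _
      · exact (rampDeriv_of_le (hδ k) ((not_lt.1 h).trans (hδ k).le)).le
    have hlim2 : Tendsto (fun k => ∫ x in Ω, a x * p x * ramp (δ k) (p x)) atTop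
        (𝓝 (∫ x in Ω, a x * φ x ^ 2)) := by
      refine tendsto_integral_of_dominated_convergence (fun _ => C * M * M)
        (fun k => (hBi k).1) (integrable_const _)
        (fun k => (ae_restrict_iff' hms).2 (ae_of_all _ (hBb k))) (ae_of_all _ fun x => ?_)
      have h1 := (tendsto_ramp hδ hδ0 (p x)).const_mul (a x * p x)
      have h2 : a x * p x * max (p x) 0 = a x * φ x ^ 2 := by
        rcases le_total (p x) 0 with h | h <;> (simp [φ, h]; try ring)
      rwa [h2] at h1
    exact le_of_tendsto_of_tendsto' hlim1 hlim2 fun k => (hgreen k).2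
  have hzero : φ =ᵐ[volume.restrict Ω] 0 := by
    by_contra hne
    linarith [hpos φ G hH hne]
  intro x hx
  -- Continuity turns almost everywhere vanishing on the open set into vanishing everywhere.
  have := Measure.eqOn_open_of_ae_eq hzero hΩ hφc continuousOn_const hx
  exact max_eq_right_iff.1 this

end MaximumPrinciple

/-! ### Convexity, reflection and the comparison of `u` with its mirror image. -/

section Reflection

/-- A convex function lies above its tangent lines. -/
theorem ConvexOn.deriv_mul_sub_le {f : ℝ → ℝ} (hf : ConvexOn ℝ Set.univ f) {s : ℝ}
    (hd : DifferentiableAt ℝ f s) (t : ℝ) : deriv f s * (t - s) ≤ f t - f s := by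
  rcases lt_trichotomy s t with h | rfl | h
  · have := hf.deriv_le_slope trivial trivial h hd
    rwa [slope_def_field, le_div_iff₀ (sub_pos.2 h)] at this
  · simp
  · have := hf.slope_le_deriv trivial trivial h hd
    rw [slope_def_field, div_le_iff₀ (sub_pos.2 h)] at this
    linarith

/-- The second derivative of `u ∘ σ` along `bᵢ` is that of `u` along `σ bᵢ`, and `σ` carries an
orthonormal basis to another. Since `σ` is invertible, no regularity of `u` is needed. -/
theorem laplacian_comp_linearIsometryEquiv {E : Type*} [NormedAddCommGroup E]
    [InnerProductSpace ℝ E] [FiniteDimensional ℝ E] (σ : E ≃ₗᵢ[ℝ] E) (u : E → ℝ) (x : E) :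
    Laplacian.laplacian (u ∘ σ) x = Laplacian.laplacian u (σ x) := by
  rw [InnerProductSpace.laplacian_eq_iteratedFDeriv_orthonormalBasis _ (stdOrthonormalBasis ℝ E),
    InnerProductSpace.laplacian_eq_iteratedFDeriv_orthonormalBasis _
      ((stdOrthonormalBasis ℝ E).map σ)]
  refine Finset.sum_congr rfl fun i _ => ?_
  have := σ.toContinuousLinearEquiv.iteratedFDerivWithin_comp_right u (s := Set.univ) (x := x)
    uniqueDiffOn_univ (Set.mem_univ _) 2
  simp only [Set.preimage_univ, iteratedFDerivWithin_univ] at this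
  rw [show u ∘ σ = u ∘ σ.toContinuousLinearEquiv from rfl, this]
  simp only [ContinuousMultilinearMap.compContinuousLinearMap_apply]
  congr 1
  ext j
  fin_cases j <;> rfl

variable {m : ℕ}

/-- The reflection `reflectLast` as a linear isometry. -/
noncomputable def reflectLastEquiv (m : ℕ) :
    EuclideanSpace ℝ (Fin (m + 1)) ≃ₗᵢ[ℝ] EuclideanSpace ℝ (Fin (m + 1)) :=
  LinearIsometryEquiv.piLpCongrRight 2 fun i =>
    if i = Fin.last m then LinearIsometryEquiv.neg ℝ else LinearIsometryEquiv.refl ℝ ℝ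

theorem reflectLastEquiv_apply (x : EuclideanSpace ℝ (Fin (m + 1))) :
    reflectLastEquiv m x = reflectLast x := by
  ext i
  simp only [reflectLastEquiv, reflectLast, LinearIsometryEquiv.piLpCongrRight_apply]
  split_ifs <;> simp

theorem reflectLast_reflectLast (x : EuclideanSpace ℝ (Fin (m + 1))) :
    reflectLast (reflectLast x) = x := by
  ext i
  simp only [reflectLast]
  split_ifs <;> simp

/-- The partial derivative in `s` is the joint derivative applied to `(0, 1)`, hence continuous
along the graph of `u`. -/
theorem continuousOn_linearizedPotential {Ω : Set (EuclideanSpace ℝ (Fin (m + 1)))}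
    (hΩ : IsOpen Ω) {f : EuclideanSpace ℝ (Fin (m + 1)) → ℝ → ℝ}
    {u : EuclideanSpace ℝ (Fin (m + 1)) → ℝ}
    (hf : ContDiffOn ℝ 1 (fun p : EuclideanSpace ℝ (Fin (m + 1)) × ℝ => f p.1 p.2)
      (Ω ×ˢ Set.univ)) (hu : ContinuousOn u Ω) :
    (∀ x ∈ Ω, ∀ s, DifferentiableAt ℝ (f x) s) ∧ ContinuousOn (linearizedPotential f u) Ω := by
  have hopen : IsOpen (Ω ×ˢ (Set.univ : Set ℝ)) := hΩ.prod isOpen_univ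
  have hder : ∀ x ∈ Ω, ∀ s, HasDerivAt (f x)
      (fderiv ℝ (fun p : EuclideanSpace ℝ (Fin (m + 1)) × ℝ => f p.1 p.2) (x, s) (0, 1)) s := by
    intro x hx s
    have h1 := ((hf.contDiffAt (hopen.mem_nhds ⟨hx, trivial⟩ :
      Ω ×ˢ (Set.univ : Set ℝ) ∈ 𝓝 (x, s))).differentiableAt (by norm_num)).hasFDerivAt
    exact h1.comp_hasDerivAt s ((hasDerivAt_const s x).prodMk (hasDerivAt_id s))
  refine ⟨fun x hx s => (hder x hx s).differentiableAt, ?_⟩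
  have hcont := (hf.continuousOn_fderiv_of_isOpen hopen le_rfl).comp
    (continuousOn_id.prodMk hu) fun x hx => ⟨hx, trivial⟩
  exact (hcont.clm_apply continuousOn_const).congr fun x hx => (hder x hx (u x)).deriv

/-- A stable solution of an equation with convex, symmetric nonlinearity lies below its
reflection. -/
theorem IsStableSolution.le_reflectLast {Ω : Set (EuclideanSpace ℝ (Fin (m + 1)))}
    (hΩ : IsBoundedSymmetricDomain Ω) {f : EuclideanSpace ℝ (Fin (m + 1)) → ℝ → ℝ}
    {u : EuclideanSpace ℝ (Fin (m + 1)) → ℝ}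
    (hf : ContDiffOn ℝ 1 (fun p : EuclideanSpace ℝ (Fin (m + 1)) × ℝ => f p.1 p.2)
      (Ω ×ˢ Set.univ))
    (hconv : ∀ x ∈ Ω, ConvexOn ℝ Set.univ (f x))
    (hsymm : ∀ x ∈ Ω, ∀ s : ℝ, f (reflectLast x) s = f x s)
    {C : ℝ} (hC : ∀ x ∈ Ω, |linearizedPotential f u x| ≤ C)
    (hu : IsStableSolution Ω f u) {x : EuclideanSpace ℝ (Fin (m + 1))} (hx : x ∈ Ω) :
    u x ≤ u (reflectLast x) := by
  let σ := reflectLastEquiv m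
  have hσ : ∀ y, σ y = reflectLast y := reflectLastEquiv_apply
  have hmaps : Set.MapsTo σ Ω Ω := fun y hy => by rw [hσ]; exact hΩ.symmetric y hy
  have hpre : σ ⁻¹' Ω = Ω := by
    refine Set.Subset.antisymm (fun y hy => ?_) hmaps
    have := hmaps hy
    rwa [hσ, hσ, reflectLast_reflectLast] at this
  have hclos : Set.MapsTo σ (closure Ω) (closure Ω) := hmaps.closure σ.continuous
  have hfront : Set.MapsTo σ (frontier Ω) (frontier Ω) := fun y hy => by
    rw [← hpre] at hy
    change y ∈ σ.toHomeomorph ⁻¹' frontier Ω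
    rwa [σ.toHomeomorph.preimage_frontier Ω]
  obtain ⟨hsol, hpos⟩ := hu
  have hu2 : ∀ y ∈ Ω, ContDiffAt ℝ 2 u y := fun y hy =>
    hsol.contDiffOn.contDiffAt (hΩ.isOpen.mem_nhds hy)
  have hv : ContDiffOn ℝ 2 (u ∘ σ) Ω :=
    hsol.contDiffOn.comp σ.contDiff.contDiffOn hmaps
  obtain ⟨hdiff, ha⟩ := continuousOn_linearizedPotential hΩ.isOpen hf
    (hsol.continuousOn.mono subset_closure)
  have hmain := nonpos_of_neg_laplacian_le_of_form_pos hΩ.isOpen hΩ.isBounded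
    (p := u - u ∘ σ) (a := linearizedPotential f u) (hsol.contDiffOn.sub hv)
    (hsol.continuousOn.sub (hsol.continuousOn.comp σ.continuous.continuousOn hclos))
    (fun y hy => by simp [hsol.boundary y hy, hsol.boundary _ (hfront hy)]) ha hC
    (fun y hy => by
      rw [ContDiffAt.laplacian_sub (hu2 y hy) (hv.contDiffAt (hΩ.isOpen.mem_nhds hy)),
        laplacian_comp_linearIsometryEquiv]
      have h1 := hsol.equation y hy
      have h2 := hsol.equation _ (hmaps hy)
      -- The tangent is taken at `u y`, not at the reflected value, so the coefficient is the one
      -- whose form is positive by stability.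
      have h3 := (hconv y hy).deriv_mul_sub_le (hdiff y hy (u y)) (u (σ y))
      rw [hσ y, hsymm y hy, ← hσ y] at h2
      simp only [linearizedPotential, Pi.sub_apply, Function.comp_apply]
      linarith)
    hpos x hx
  simpa [hσ] using hmain

theorem IsStableSolution.reflectLast_eq {Ω : Set (EuclideanSpace ℝ (Fin (m + 1)))}
    (hΩ : IsBoundedSymmetricDomain Ω) {f : EuclideanSpace ℝ (Fin (m + 1)) → ℝ → ℝ}
    {u : EuclideanSpace ℝ (Fin (m + 1)) → ℝ}
    (hf : ContDiffOn ℝ 1 (fun p : EuclideanSpace ℝ (Fin (m + 1)) × ℝ => f p.1 p.2)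
      (Ω ×ˢ Set.univ))
    (hconv : ∀ x ∈ Ω, ConvexOn ℝ Set.univ (f x))
    (hsymm : ∀ x ∈ Ω, ∀ s : ℝ, f (reflectLast x) s = f x s)
    {C : ℝ} (hC : ∀ x ∈ Ω, |linearizedPotential f u x| ≤ C)
    (hu : IsStableSolution Ω f u) {x : EuclideanSpace ℝ (Fin (m + 1))} (hx : x ∈ Ω) :
    u (reflectLast x) = u x := by
  refine le_antisymm ?_ (hu.le_reflectLast hΩ hf hconv hsymm hC hx)
  have := hu.le_reflectLast hΩ hf hconv hsymm hC (hΩ.symmetric x hx)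
  rwa [reflectLast_reflectLast] at this

end Reflection

theorem lemma3p2 {m : ℕ} (Ω : Set (EuclideanSpace ℝ (Fin (m + 1))))
    (hΩ : IsBoundedSymmetricDomain Ω) :
    -- the equation `-Δu = f(x, u)`
    (∀ (f : EuclideanSpace ℝ (Fin (m + 1)) → ℝ → ℝ) (u : EuclideanSpace ℝ (Fin (m + 1)) → ℝ),
      ContDiffOn ℝ 1 (fun p : EuclideanSpace ℝ (Fin (m + 1)) × ℝ => f p.1 p.2)
        (Ω ×ˢ Set.univ) →
      (∀ x ∈ Ω, ConvexOn ℝ Set.univ (f x)) →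
      (∀ x ∈ Ω, ∀ s : ℝ, f (reflectLast x) s = f x s) →
      (∃ C : ℝ, ∀ x ∈ Ω, |linearizedPotential f u x| ≤ C) →
      IsStableSolution Ω f u →
      ∀ x ∈ Ω, u (reflectLast x) = u x) ∧
    -- the autonomous equation `-Δu = f(u)`
    (∀ (f : ℝ → ℝ) (u : EuclideanSpace ℝ (Fin (m + 1)) → ℝ),
      ContDiff ℝ 1 f →
      ConvexOn ℝ Set.univ f →
      IsStableSolution Ω (fun _ s => f s) u →
      ∀ x ∈ Ω, u (reflectLast x) = u x) := by
  refine ⟨fun f u hf hconv hsymm ⟨C, hC⟩ hu x hx => hu.reflectLast_eq hΩ hf hconv hsymm hC hx,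
    fun f u hf hconv hu x hx => ?_⟩
  -- In the autonomous case the bound on the potential is automatic: `f'(u)` is continuous on the
  -- compact set `closure Ω`.
  obtain ⟨C, hC⟩ := hΩ.isBounded.isCompact_closure.exists_bound_of_continuousOn
    ((hf.continuous_deriv le_rfl).comp_continuousOn hu.isSolution.continuousOn)
  exact hu.reflectLast_eq hΩ (hf.comp contDiff_snd).contDiffOn (fun _ _ => hconv)
    (fun _ _ _ => rfl) (fun y hy => hC y (subset_closure hy)) hx
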